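/- Consider an $N$-relay Gaussian half-duplex 1-2-1 network with nodes $0,1,\dots,N+1$ ($0$ the source, $N+1$ the destination), channel coefficients $h_{ji}\in\mathbb C$ from node $i$ to node $j$, power $P\ge 0$, and link capacities $\ell_{j,i}=\log(1+P|h_{ji}|^2)$ for $(i,j)\in[0{:}N]\times[1{:}N{+}1]$. A state $s$ consists of sets $s_{i,t}\subseteq[1{:}N{+}1]\setminus\{i\}$ and $s_{i,r}\subseteq[0{:}N]\setminus\{i\}$ for $i\in[0{:}N{+}1]$ with $|s_{i,t}|\le 1$, $|s_{i,r}|\le 1$, $|s_{i,t}|+|s_{i,r}|\le 1$ and $s_{0,r}=s_{N+1,t}=\emptyset$. Let $$\mathsf C_{\rm cs,iid}=\max_{\lambda_s\ge 0,\ \sum_s\lambda_s=1}\ \ \min_{\Omega\subseteq[0:N],\ 0\in\Omega}\ \ \sum_{i\in\Omega,\ j\in\Omega^c}\Bigl(\sum_{s:\ j\in s_{i,t},\ i\in s_{j,r}}\lambda_s\Bigr)\ell_{j,i},\qquad \Omega^c=[0{:}N{+}1]\setminus\Omega ,$$ where the maximum is over all assignments of time fractions $\lambda_s$ to the states $s$.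 Then the maximum exists and equals the (attained) optimal value of the linear program $$\mathrm{P1}:\quad \max\ \sum_{j=1}^{N+1}F_{j,0}$$ in real variables $F_{j,i}$ ($(i,j)\in[0{:}N]\times[1{:}N{+}1]$), $\lambda_{ij}$ ($i,j\in[0{:}N{+}1]$) and $\hat\lambda_{ij}$ ($0\le i<j\le N+1$), subject to - (1a) $0\le F_{j,i}\le\lambda_{ji}\,\ell_{j,i}$ for all $(i,j)\in[0{:}N]\times[1{:}N{+}1]$; - (1b) $\sum_{j\in[1:N+1]\setminus\{i\}}F_{j,i}=\sum_{k\in[0:N]\setminus\{i\}}F_{i,k}$ for all $i\in[1{:}N]$; - (1c) $\hat\lambda_{ij}=\lambda_{ij}+\lambda_{ji}$ for all $0\le i<j\le N+1$; - (1d) $\lambda_{ij}\ge 0$ for all $i,j\in[0{:}N{+}1]$; - (1e) $\sum_{(i,j):\ i<j,\ i=v\text{ or }j=v}\hat\lambda_{ij}\le 1$ for all $v\in[0{:}N{+}1]$; - (1f) $\sum_{i,j\in S,\ i<j}\hat\lambda_{ij}\le\frac{|S|-1}{2}$ for all $S\subseteq[0{:}N{+}1]$ with $|S|$ odd; - (1g)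 $\hat\lambda_{ij}\ge 0$ for all $0\le i<j\le N+1$. Here $F_{j,i}$ is the flow through the link from $i$ to $j$, and $\lambda_{ji}$ is the fraction of time for which that link is active. -/

import Mathlib

open scoped BigOperators

namespace OneTwoOne

/-- The nodes `0, 1, ..., N+1` of an `N`-relay network: `0` is the source, `N+1` (that is,
`Fin.last (N+1)`) is the destination, and the nodes in between are the relays. -/
abbrev Node (N : ℕ) : Type := Fin (N + 2)

/-- The source node `0`. -/
abbrev src (N : ℕ) : Node N := 0

/-- The destination node `N+1`. -/
abbrev dst (N : ℕ) : Node N := Fin.last (N + 1)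

/-- A state of the half-duplex 1-2-1 network: `tx i` is the set of nodes (at most one) towards
which node `i` points its transmitting beam, and `rx i` the set of nodes (at most one) towards
which it points its receiving beam. -/
@[ext]
structure State (N : ℕ) : Type where
  tx : Node N → Finset (Node N)
  rx : Node N → Finset (Node N)
  tx_range : ∀ i, ∀ j ∈ tx i, j ≠ src N ∧ j ≠ i
  rx_range : ∀ i, ∀ j ∈ rx i, j ≠ dst N ∧ j ≠ i
  tx_card : ∀ i, (tx i).card ≤ 1
  rx_card : ∀ i, (rx i).card ≤ 1
  half_duplex : ∀ i, (tx i).card + (rx i).card ≤ 1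
  src_rx : rx (src N) = ∅
  dst_tx : tx (dst N) = ∅

instance (N : ℕ) : Finite (State N) :=
  Finite.of_injective
    (fun s : State N => ((s.tx, s.rx) :
      (Node N → Finset (Node N)) × (Node N → Finset (Node N))))
    (fun _ _ hst => State.ext (congrArg Prod.fst hst) (congrArg Prod.snd hst))

noncomputable instance (N : ℕ) : Fintype (State N) := Fintype.ofFinite _

/-- The point-to-point capacity `ℓ_{j,i} = log (1 + P |h_{ji}|²)` of the link from `i` to `j`. -/
noncomputable def linkCap {N : ℕ} (h : Node N → Node N → ℂ) (P : ℝ) (j i : Node N) : ℝ :=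
  Real.log (1 + P * ‖h j i‖ ^ 2)

/-- A schedule: the fraction of time for which each state is active. -/
def IsSchedule {N : ℕ} (lam : State N → ℝ) : Prop :=
  (∀ s, 0 ≤ lam s) ∧ ∑ s, lam s = 1

/-- The effective activation time `A_{ji}` of the link from `i` to `j` under a schedule. -/
noncomputable def activation {N : ℕ} (lam : State N → ℝ) (j i : Node N) : ℝ :=
  ∑ s : State N with j ∈ s.tx i ∧ i ∈ s.rx j, lam s

/-- The cuts: sets `Ω` of nodes that contain the source and not the destination. -/
abbrev Cut (N : ℕ) : Type := {Ω : Finset (Node N) // src N ∈ Ω ∧ dst N ∉ Ω}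

/-- The value of a cut when the link capacities are weighted by the activation times. -/
noncomputable def cutValue {N : ℕ} (h : Node N → Node N → ℂ) (P : ℝ) (lam : State N → ℝ)
    (Ω : Finset (Node N)) : ℝ :=
  ∑ i ∈ Ω, ∑ j ∈ Ωᶜ, activation lam j i * linkCap h P j i

/-- The min-cut for a fixed schedule (a minimum over the finite non-empty type of cuts). -/
noncomputable def minCut {N : ℕ} (h : Node N → Node N → ℂ) (P : ℝ) (lam : State N → ℝ) : ℝ :=
  ⨅ Ω : Cut N, cutValue h P lam Ω

/-- The min-cuts that are obtained by all schedules. -/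
def minCutValues {N : ℕ} (h : Node N → Node N → ℂ) (P : ℝ) : Set ℝ :=
  {c | ∃ lam : State N → ℝ, IsSchedule lam ∧ c = minCut h P lam}

/-- The approximate capacity `C_{cs,iid}`: the best min-cut over all schedules. -/
noncomputable def approxCapacity {N : ℕ} (h : Node N → Node N → ℂ) (P : ℝ) : ℝ :=
  sSup (minCutValues h P)

/-- The constraints of the linear program `P1` in the variables `F j i` (flow from `i` to `j`),
`lam j i` (activation time of the link from `i` to `j`) and `lamHat i j` for `i < j`.
Only the entries `F j i` with `i ≠ N+1` and `j ≠ 0` take part. -/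
structure P1Feasible {N : ℕ} (h : Node N → Node N → ℂ) (P : ℝ)
    (F lam lamHat : Node N → Node N → ℝ) : Prop where
  capacity : ∀ i j, i ≠ dst N → j ≠ src N → 0 ≤ F j i ∧ F j i ≤ lam j i * linkCap h P j i
  conservation : ∀ i, i ≠ src N → i ≠ dst N →
    ∑ j with j ≠ src N ∧ j ≠ i, F j i = ∑ k with k ≠ dst N ∧ k ≠ i, F i k
  lamHat_eq : ∀ i j, i < j → lamHat i j = lam i j + lam j i
  lam_nonneg : ∀ i j, 0 ≤ lam i j
  degree : ∀ v : Node N,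
    ∑ p : Node N × Node N with (p.1 = v ∨ p.2 = v) ∧ p.1 < p.2, lamHat p.1 p.2 ≤ 1
  odd_set : ∀ S : Finset (Node N), Odd S.card →
    ∑ p : Node N × Node N with p.1 ∈ S ∧ p.2 ∈ S ∧ p.1 < p.2, lamHat p.1 p.2
      ≤ ((S.card : ℝ) - 1) / 2
  lamHat_nonneg : ∀ i j, i < j → 0 ≤ lamHat i j

/-- The objective values `∑_{j=1}^{N+1} F_{j,0}` of the feasible points of `P1`. -/
def P1Values {N : ℕ} (h : Node N → Node N → ℂ) (P : ℝ) : Set ℝ :=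
  {c | ∃ F lam lamHat : Node N → Node N → ℝ,
    P1Feasible h P F lam lamHat ∧ c = ∑ j with j ≠ src N, F j (src N)}

end OneTwoOne

/-! For a fixed schedule, max-flow min-cut (`exists_flow_eq_cut`) turns the minimum cut into a
maximum flow whose capacities are activation times multiplied by link capacities. It remains to
describe the achievable activation times. By half-duplex, the links active in one state form a
matching, so symmetrised activation times average matchings and obey the degree and odd-set
constraints. Thus every schedule yields a feasible point of P1 with objective its min-cut.

Conversely, Edmonds' theorem (`IsFracMatching.exists_involutive_le`) bounds every nonnegative linear
functional on a fractional matching by its value at some matching. Orienting each matched edge in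
its heavier direction makes that matching a state. Separating convex sets then gives a schedule
whose activation times dominate the given ones (`exists_schedule_activation_ge`); domination
suffices, since larger capacities still carry the flow.

Edmonds' theorem is proved by maximising a normalised violation. At a maximiser, Gallai's lemma
gives a degree or odd-set inequality that is tight on all optimal matchings; subtracting a small
multiple of it from the weights gives a larger normalised violation. -/

namespace OneTwoOne

/-! ### Edmonds' matching polytope theorem. -/

section Matching

variable {V : Type*} [Fintype V]

/-- Matchings of `V` are encoded as involutions, the fixed points being the uncovered vertices.
This is twice the weight of such a matching. -/
def invWeight (w : V → V → ℝ) (σ : V → V) : ℝ := ∑ v, w v (σ v)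

/-- Symmetric nonnegative edge weights on the complete graph. -/
structure IsWeight (w : V → V → ℝ) : Prop where
  nonneg : ∀ a b, 0 ≤ w a b
  symm : ∀ a b, w a b = w b a
  diag : ∀ a, w a a = 0

/-- A maximum-weight matching all of whose edges have positive weight. -/
structure IsOptimal (w : V → V → ℝ) (σ : V → V) : Prop where
  invol : Function.Involutive σ
  supp : ∀ a, σ a ≠ a → 0 < w a (σ a)
  max : ∀ τ, Function.Involutive τ → invWeight w τ ≤ invWeight w σ

/-- In the union of the two matchings, the component of `t` is a path with one end at `t`, missed by
τ; at most one vertex of it can be missed by σ. Algebraically, the component is the orbit of `t`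
under ρ = στ, on whose exponents τ acts as k ↦ -k and σ as k ↦ 1 - k. -/
theorem exists_invariant_separating {V : Type*} {σ τ : V → V} (hσ : Function.Involutive σ)
    (hτ : Function.Involutive τ) {t u v : V} (ht : τ t = t) (hu : σ u = u) (hv : σ v = v)
    (huv : u ≠ v) :
    ∃ P : Set V, (∀ a ∈ P, σ a ∈ P) ∧ (∀ a ∈ P, τ a ∈ P) ∧ t ∈ P ∧ (u ∉ P ∨ v ∉ P) := by
  set s : Equiv.Perm V := hσ.toPerm
  set r : Equiv.Perm V := hτ.toPerm
  have hs : s * s = 1 := by ext a; exact hσ a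
  have hr : r * r = 1 := by ext a; exact hτ a
  have hs' : s⁻¹ = s := inv_eq_of_mul_eq_one_right hs
  have hr' : r⁻¹ = r := inv_eq_of_mul_eq_one_right hr
  set ρ := s * r with hρ
  have hρi : ρ⁻¹ = r * s := by rw [hρ, mul_inv_rev, hs', hr']
  have hrk : ∀ k : ℤ, r * ρ ^ k = ρ ^ (-k) * r := by
    intro k
    have h1 : r * ρ * r⁻¹ = ρ⁻¹ := by rw [hρi, hr', hρ]; simp only [mul_assoc, hr, mul_one]
    have h2 := conj_zpow (i := k) (a := r) (b := ρ)
    rw [h1, inv_zpow'] at h2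
    rw [h2]; group
  have hsk : ∀ k : ℤ, s * ρ ^ k = ρ ^ (-k) * s := by
    intro k
    have h1 : s * ρ * s⁻¹ = ρ⁻¹ := by
      rw [hρi, hs', hρ, ← mul_assoc, hs, one_mul]
    have h2 := conj_zpow (i := k) (a := s) (b := ρ)
    rw [h1, inv_zpow'] at h2
    rw [h2]; group
  have hst : s t = ρ t := by
    change s t = s (τ t); rw [ht]
  have hsρ : ∀ k : ℤ, s ((ρ ^ k) t) = (ρ ^ (1 - k)) t := by
    intro k
    have := congrArg (fun e : Equiv.Perm V => e t) (hsk k)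
    simp only [Equiv.Perm.mul_apply, hst] at this
    rw [this, ← Equiv.Perm.mul_apply, ← zpow_add_one]
    congr 2; ring
  refine ⟨{a | ∃ k : ℤ, (ρ ^ k) t = a}, ?_, ?_, ⟨0, by simp⟩, ?_⟩
  · rintro a ⟨k, rfl⟩
    exact ⟨1 - k, (hsρ k).symm⟩
  · rintro a ⟨k, rfl⟩
    refine ⟨-k, ?_⟩
    have := congrArg (fun e : Equiv.Perm V => e t) (hrk k)
    simp only [Equiv.Perm.mul_apply] at this
    change _ = r _
    rw [this]
    change _ = (ρ ^ (-k)) (τ t)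
    rw [ht]
  · by_contra! hcon
    obtain ⟨⟨k, rfl⟩, ⟨l, rfl⟩⟩ := hcon
    -- A σ-fixed point ρ^k t makes 2k - 1 a period of `t`. The difference k - l is an integer
    -- combination of 2k - 1 and 2l - 1, hence also a period, which forces u = v.
    have period : ∀ k : ℤ, σ ((ρ ^ k) t) = (ρ ^ k) t → (ρ ^ (2 * k - 1)) t = t := by
      intro k hk
      have h1 : (ρ ^ (1 - k)) t = (ρ ^ k) t := (hsρ k).symm.trans hk
      have h2 : (ρ ^ (2 * k - 1)) t = (ρ ^ (k - 1)) ((ρ ^ k) t) := by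
        rw [← Equiv.Perm.mul_apply, ← zpow_add]; congr 2; ring
      rw [h2, ← h1, ← Equiv.Perm.mul_apply, ← zpow_add]
      simp
    have hk := period k hu
    have hl := period l hv
    have mulp : ∀ m n : ℤ, (ρ ^ m) t = t → (ρ ^ (m * n)) t = t := by
      intro m n h
      rw [zpow_mul]
      exact Function.IsFixedPt.perm_zpow h n
    apply huv
    have h3 : (ρ ^ (k - l)) t = t := by
      have e : k - l = (2 * k - 1) * l + (2 * l - 1) * (-k) := by ring
      rw [e, zpow_add, Equiv.Perm.mul_apply, mulp _ _ hl, mulp _ _ hk]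
    have h4 : (ρ ^ k) t = (ρ ^ l) ((ρ ^ (k - l)) t) := by
      rw [← Equiv.Perm.mul_apply, ← zpow_add]; congr 2; ring
    rw [h4, h3]

theorem piecewise_involutive {V : Type*} {σ τ : V → V} (hσ : Function.Involutive σ)
    (hτ : Function.Involutive τ) {P : Set V} [DecidablePred (· ∈ P)]
    (hPσ : ∀ a ∈ P, σ a ∈ P) (hPτ : ∀ a ∈ P, τ a ∈ P) :
    Function.Involutive (P.piecewise τ σ) := by
  intro a
  by_cases ha : a ∈ P
  · rw [Set.piecewise_eq_of_mem P _ _ ha, Set.piecewise_eq_of_mem P _ _ (hPτ a ha), hτ a]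
  · have : σ a ∉ P := fun h => ha (by simpa [hσ a] using hPσ _ h)
    rw [Set.piecewise_eq_of_notMem P _ _ ha, Set.piecewise_eq_of_notMem P _ _ this, hσ a]

/-- Exchanging the two matchings on an invariant set preserves the sum of their weights, so neither
result can fall below the optimum. -/
theorem IsOptimal.piecewise {w : V → V → ℝ} {σ τ : V → V} (hσ : IsOptimal w σ)
    (hτ : IsOptimal w τ) {P : Set V} [DecidablePred (· ∈ P)]
    (hPσ : ∀ a ∈ P, σ a ∈ P) (hPτ : ∀ a ∈ P, τ a ∈ P) :
    IsOptimal w (P.piecewise τ σ) := by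
  have hinv := piecewise_involutive hσ.invol hτ.invol hPσ hPτ
  refine ⟨hinv, fun a ha => ?_, fun θ hθ => ?_⟩
  · by_cases h : a ∈ P
    · rw [Set.piecewise_eq_of_mem P _ _ h] at ha ⊢; exact hτ.supp a ha
    · rw [Set.piecewise_eq_of_notMem P _ _ h] at ha ⊢; exact hσ.supp a ha
  · have h1 := hσ.max _ (piecewise_involutive hτ.invol hσ.invol hPτ hPσ)
    have h2 : invWeight w (P.piecewise τ σ) + invWeight w (P.piecewise σ τ)
        = invWeight w σ + invWeight w τ := by
      simp only [invWeight, ← Finset.sum_add_distrib]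
      refine Finset.sum_congr rfl fun a _ => ?_
      by_cases h : a ∈ P
      · simp [h, add_comm]
      · simp [h]
    have h3 := hτ.max θ hθ
    linarith

/-- Otherwise adding the edge `uv` would increase the weight of the matching. -/
theorem IsOptimal.not_pos_of_fixed {w : V → V → ℝ} (hw : IsWeight w) {σ : V → V}
    (hσ : IsOptimal w σ) {u v : V} (hu : σ u = u) (hv : σ v = v) : ¬ 0 < w u v := by
  intro hpos
  have huv : u ≠ v := by rintro rfl; simp [hw.diag] at hpos
  classical
  have h := hσ.max (({u, v} : Set V).piecewise (Equiv.swap u v) σ) <| by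
    refine piecewise_involutive hσ.invol (fun a => Equiv.swap_apply_self u v a)
      ?_ ?_ <;> simp [hu, hv]
  refine absurd h (not_le.2 ?_)
  refine Finset.sum_lt_sum (fun a _ => ?_) ⟨u, Finset.mem_univ _, by simp [hu, hw.diag, hpos]⟩
  by_cases ha : a ∈ ({u, v} : Set V)
  · rw [Set.piecewise_eq_of_mem _ _ _ ha]
    have : σ a = a := by rcases ha with rfl | rfl <;> assumption
    rw [this, hw.diag]
    exact hw.nonneg _ _
  · rw [Set.piecewise_eq_of_notMem _ _ _ ha]

/-- Gallai's lemma for weighted matchings. -/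
theorem IsOptimal.eq_of_fixed {w : V → V → ℝ} (hw : IsWeight w) {u v : V}
    (huv : Relation.ReflTransGen (fun a b => 0 < w a b) u v)
    (hmiss : ∀ t, Relation.ReflTransGen (fun a b => 0 < w a b) t v → ∃ τ, IsOptimal w τ ∧ τ t = t)
    {σ : V → V} (hσ : IsOptimal w σ) (hu : σ u = u) (hv : σ v = v) : u = v := by
  classical
  induction huv using Relation.ReflTransGen.head_induction_on generalizing σ with
  | refl => rfl
  | @head u t hut htv ih =>
    by_contra hne
    -- Exchange σ with a τ missing `t` on the component of `t`. If this component avoids `u`, the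
    -- result misses both ends of the positive edge `ut`. If it avoids `v`, the result misses `t`
    -- and `v`, so induction gives t = v, although `t` lies in the component.
    obtain ⟨τ, hτ, ht⟩ := hmiss t htv
    obtain ⟨P, hPσ, hPτ, htP, h | h⟩ :=
      exists_invariant_separating hσ.invol hτ.invol ht hu hv hne
    · refine (hσ.piecewise hτ hPσ hPτ).not_pos_of_fixed hw (u := u) (v := t) ?_ ?_ hut
      · simp [h, hu]
      · simp [htP, ht]
    · have htv' : t = v := ih (hσ.piecewise hτ hPσ hPτ) (by simp [htP, ht]) (by simp [h, hv])
      exact h (htv' ▸ htP)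

/-- Removing the edges of weight zero from a matching. -/
theorem exists_supported {w : V → V → ℝ} (hw : IsWeight w) {σ : V → V}
    (hσ : Function.Involutive σ) : ∃ τ : V → V, Function.Involutive τ ∧
      (∀ a, τ a ≠ a → 0 < w a (τ a)) ∧
      ∀ w' : V → V → ℝ, IsWeight w' → (∀ a b, w a b = 0 → w' a b = 0) →
        invWeight w' τ = invWeight w' σ := by
  classical
  refine ⟨fun a => if 0 < w a (σ a) then σ a else a, fun a => ?_, fun a ha => ?_,
    fun w' hw' h0 => Finset.sum_congr rfl fun a _ => ?_⟩
  · by_cases h : 0 < w a (σ a)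
    · have h' : 0 < w (σ a) a := by rwa [hw.symm]
      simp [h, h', hσ a]
    · simp [h]
  · by_cases h : 0 < w a (σ a)
    · simp [h]
    · simp [h] at ha
  · by_cases h : 0 < w a (σ a)
    · simp [h]
    · have : w a (σ a) = 0 := le_antisymm (not_lt.1 h) (hw.nonneg _ _)
      simp [h, hw'.diag, h0 _ _ this]

/-- Fractional matchings: symmetric matrices satisfying the degree and odd-set constraints. -/
structure IsFracMatching (x : V → V → ℝ) : Prop where
  nonneg : ∀ a b, 0 ≤ x a b
  symm : ∀ a b, x a b = x b a
  degree : ∀ a, ∑ b, x a b ≤ 1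
  odd_set : ∀ S : Finset V, Odd S.card → ∑ a ∈ S, ∑ b ∈ S, x a b ≤ S.card - 1

/-- A valid inequality `∑ c x ≤ K` for fractional matchings, supported on the edges of positive
weight, that is tight on all optimal matchings. -/
structure IsTightInequality (w c : V → V → ℝ) (K : ℝ) : Prop where
  weight : IsWeight c
  le_one : ∀ a b, c a b ≤ 1
  supp : ∀ a b, w a b = 0 → c a b = 0
  ne_zero : ∃ a b, 0 < c a b
  valid : ∀ x, IsFracMatching x → ∑ a, ∑ b, c a b * x a b ≤ K
  tight : ∀ σ, IsOptimal w σ → K ≤ invWeight c σ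

-- The degree constraint at `u` is tight because every optimal matching covers `u`. The bound is 2
-- because each edge is counted in both orders.
open Classical in
theorem isTightInequality_star {w : V → V → ℝ} (hw : IsWeight w) {u v : V} (huv : 0 < w u v)
    (hu : ∀ σ, IsOptimal w σ → σ u ≠ u) :
    IsTightInequality w (fun a b => if (a = u ∨ b = u) ∧ 0 < w a b then 1 else 0) 2 where
  weight :=
    { nonneg := fun a b => by positivity
      symm := fun a b => by simp only [hw.symm a b, or_comm]
      diag := fun a => by simp [hw.diag] }
  le_one a b := by split_ifs <;> norm_num
  supp a b h := by simp [h]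
  ne_zero := ⟨u, v, by simp [huv]⟩
  valid x hx := by
    have h1 : ∀ a b, (if (a = u ∨ b = u) ∧ 0 < w a b then (1 : ℝ) else 0) * x a b
        ≤ (if a = u then x a b else 0) + (if b = u then x a b else 0) := by
      intro a b
      have := hx.nonneg a b
      split_ifs <;> first | linarith | tauto
    calc _ ≤ ∑ a, ∑ b, ((if a = u then x a b else 0) + (if b = u then x a b else 0)) :=
          Finset.sum_le_sum fun a _ => Finset.sum_le_sum fun b _ => h1 a b
      _ = ∑ b, x u b + ∑ a, x a u := by
          simp only [Finset.sum_add_distrib]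
          congr 1
          · rw [Finset.sum_comm]; simp
          · simp
      _ ≤ 2 := by
          have h2 := hx.degree u
          have h3 : ∑ a, x a u = ∑ b, x u b := Finset.sum_congr rfl fun a _ => hx.symm a u
          linarith
  tight σ hσ := by
    have hne := hu σ hσ
    have hpos := hσ.supp u hne
    have h := Finset.add_le_sum (s := Finset.univ)
      (f := fun a => if (a = u ∨ σ a = u) ∧ 0 < w a (σ a) then (1 : ℝ) else 0)
      (fun a _ => by positivity) (Finset.mem_univ u) (Finset.mem_univ (σ u)) hne.symm
    have h' : 0 < w (σ u) u := by rwa [hw.symm]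
    simp only [hσ.invol u, hpos, h', true_or, or_true, and_self, if_true] at h
    simp only [invWeight]
    linarith

theorem even_card_of_involutive {V : Type*} {S : Finset V} {σ : V → V} (hσ : Function.Involutive σ)
    (hS : ∀ a ∈ S, σ a ∈ S) (hne : ∀ a ∈ S, σ a ≠ a) : Even S.card := by
  rw [← ZMod.natCast_eq_zero_iff_even]
  have := Finset.sum_involution (s := S) (f := fun _ => (1 : ZMod 2)) (fun a _ => σ a)
    (fun a _ => by decide) (fun a ha _ => hne a ha) (fun a ha => hS a ha) (fun a _ => hσ a)
  simpa using this

-- By Gallai's lemma an optimal matching misses at most one vertex of the component of `u`. Since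
-- some optimal matching misses `u`, the component is odd, and its odd-set constraint is tight.
open Classical in
theorem isTightInequality_component {w : V → V → ℝ} (hw : IsWeight w) {u v : V}
    (huv : 0 < w u v)
    (hmiss : ∀ t, Relation.ReflTransGen (fun a b => 0 < w a b) t u → ∃ τ, IsOptimal w τ ∧ τ t = t) :
    ∃ c K, IsTightInequality w c K := by
  set r : V → V → Prop := fun a b => 0 < w a b
  have hr : Std.Symm (Relation.ReflTransGen r) := 
    @Relation.ReflTransGen.stdSymm _ _ ⟨fun a b h => by simpa only [r, hw.symm b a] using h⟩
  set U : Finset V := Finset.univ.filter fun a => Relation.ReflTransGen r a u with hU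
  have hmem : ∀ a, a ∈ U ↔ Relation.ReflTransGen r a u := fun a => by simp [hU]
  have hstep : ∀ a b, a ∈ U → 0 < w a b → b ∈ U := fun a b ha hab => by
    rw [hmem] at ha ⊢
    exact Relation.ReflTransGen.head (by simpa only [r, hw.symm b a] using hab) ha
  have hmap : ∀ σ, IsOptimal w σ → ∀ a ∈ U, σ a ∈ U := fun σ hσ a ha => by
    by_cases h : σ a = a
    · rwa [h]
    · exact hstep a _ ha (hσ.supp a h)
  have huU : u ∈ U := (hmem u).2 .refl
  have huniq : ∀ σ, IsOptimal w σ → ∀ a ∈ U, ∀ b ∈ U, σ a = a → σ b = b → a = b := by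
    intro σ hσ a ha b hb hsa hsb
    rw [hmem] at ha hb
    exact hσ.eq_of_fixed hw (ha.trans (hr.symm _ _ hb))
      (fun t ht => hmiss t (ht.trans hb)) hsa hsb
  have hodd : Odd U.card := by
    obtain ⟨τ, hτ, hτu⟩ := hmiss u .refl
    have := even_card_of_involutive (S := U.erase u) hτ.invol
      (fun a ha => by
        rw [Finset.mem_erase] at ha ⊢
        refine ⟨fun h => ha.1 ?_, hmap τ hτ a ha.2⟩
        rw [← hτ.invol a, h, hτu])
      (fun a ha h => by
        rw [Finset.mem_erase] at ha
        exact ha.1 (huniq τ hτ a ha.2 u huU h hτu))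
    rw [← Finset.card_erase_add_one huU]
    exact this.add_one
  refine ⟨fun a b => if a ∈ U ∧ 0 < w a b then 1 else 0, U.card - 1,
    ⟨fun a b => by positivity, fun a b => ?_, fun a => by simp [hw.diag]⟩,
    fun a b => by split_ifs <;> norm_num, fun a b h => by simp [h],
    ⟨u, v, by simp [huv, huU]⟩, fun x hx => ?_, fun σ hσ => ?_⟩
  · by_cases h : 0 < w a b
    · have h' : 0 < w b a := by rwa [hw.symm]
      have : a ∈ U ↔ b ∈ U := ⟨fun ha => hstep _ _ ha h, fun hb => hstep _ _ hb h'⟩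
      simp [h, h', this]
    · have h' : ¬ 0 < w b a := by rwa [hw.symm]
      simp [h, h']
  · refine le_trans ?_ (hx.odd_set U hodd)
    rw [← Finset.sum_subset (Finset.subset_univ U) (fun a _ ha => by simp [ha])]
    refine Finset.sum_le_sum fun a ha => ?_
    rw [← Finset.sum_subset (Finset.subset_univ U) (fun b _ hb => ?_)]
    · refine Finset.sum_le_sum fun b _ => ?_
      have := hx.nonneg a b
      split_ifs <;> linarith
    · rw [if_neg fun h => hb (hstep a b ha h.2), zero_mul]
  · obtain ⟨m, hm⟩ : ∃ m, ∀ a ∈ U, a ≠ m → σ a ≠ a := by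
      by_cases h : ∃ m ∈ U, σ m = m
      · obtain ⟨m, hmU, hm⟩ := h
        exact ⟨m, fun a ha hne h => hne (huniq σ hσ a ha m hmU h hm)⟩
      · push Not at h
        exact ⟨u, fun a ha _ => h a ha⟩
    have h1 : ((U.erase m).card : ℝ) ≤ invWeight
        (fun a b => if a ∈ U ∧ 0 < w a b then (1 : ℝ) else 0) σ := by
      rw [Finset.cast_card]
      refine (Finset.sum_le_sum fun a ha => ?_).trans
        (Finset.sum_le_sum_of_subset_of_nonneg (Finset.subset_univ _) fun a _ _ => by positivity)
      rw [Finset.mem_erase] at ha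
      simp [ha.2, hσ.supp a (hm a ha.2 ha.1)]
    have h2 : (U.card : ℝ) - 1 ≤ (U.erase m).card := by
      have := Finset.pred_card_le_card_erase (s := U) (a := m)
      rw [sub_le_iff_le_add]
      exact_mod_cast Nat.le_add_of_sub_le this
    exact h2.trans h1

theorem exists_tightInequality {w : V → V → ℝ} (hw : IsWeight w) {u v : V} (huv : 0 < w u v) :
    ∃ c K, IsTightInequality w c K := by
  by_cases h : ∀ t, Relation.ReflTransGen (fun a b => 0 < w a b) t u →
      ∃ τ, IsOptimal w τ ∧ τ t = t
  · exact isTightInequality_component hw huv h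
  · push Not at h
    obtain ⟨t, htu, ht⟩ := h
    obtain ⟨s, hts⟩ : ∃ s, 0 < w t s := by
      rcases htu.cases_head with rfl | ⟨s, hs, -⟩
      · exact ⟨v, huv⟩
      · exact ⟨s, hs⟩
    exact ⟨_, _, isTightInequality_star hw hts ht⟩

/-- Moving against a tight inequality decreases the optimum at least proportionally. -/
theorem IsTightInequality.exists_perturbation {w c : V → V → ℝ} {K : ℝ} (hw : IsWeight w)
    (hc : IsTightInequality w c K) :
    ∃ ε > 0, IsWeight (fun a b => w a b - ε * c a b) ∧
      ∀ M, (∀ τ, Function.Involutive τ → invWeight w τ ≤ M) → ∀ σ, Function.Involutive σ →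
        invWeight (fun a b => w a b - ε * c a b) σ ≤ M - ε * K := by
  classical
  obtain ⟨σ₀, hσ₀, hmax⟩ := Set.exists_max_image {σ : V → V | Function.Involutive σ}
    (invWeight w) (Set.toFinite _) ⟨id, fun _ => rfl⟩
  have hlin : ∀ ε σ, invWeight (fun a b => w a b - ε * c a b) σ
      = invWeight w σ - ε * invWeight c σ := fun ε σ => by
    simp [invWeight, Finset.sum_sub_distrib, Finset.mul_sum]
  have small : ∀ p q : ℝ, 0 < q → ∀ᶠ ε in nhdsWithin (0 : ℝ) (Set.Ioi 0), ε * p ≤ q := by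
    intro p q hq
    have : Filter.Tendsto (fun ε : ℝ => ε * p) (nhdsWithin 0 (Set.Ioi 0)) (nhds 0) := by
      have h : Continuous fun ε : ℝ => ε * p := by fun_prop
      simpa using (h.tendsto 0).mono_left nhdsWithin_le_nhds
    exact (this.eventually (gt_mem_nhds hq)).mono fun _ h => le_of_lt h
  have e1 : ∀ᶠ ε in nhdsWithin (0 : ℝ) (Set.Ioi 0), ∀ a b, ε * c a b ≤ w a b := by
    rw [Filter.eventually_all]; intro a
    rw [Filter.eventually_all]; intro b
    rcases (hw.nonneg a b).eq_or_lt with h | h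
    · simp [hc.supp a b h.symm, ← h]
    · exact small _ _ h
  -- Among finitely many matchings the non-optimal ones lie below the optimum by a gap, which
  -- absorbs ε K; the optimal ones are handled by tightness.
  have e2 : ∀ᶠ ε in nhdsWithin (0 : ℝ) (Set.Ioi 0), ∀ σ : V → V,
      invWeight w σ < invWeight w σ₀ → ε * K ≤ invWeight w σ₀ - invWeight w σ := by
    rw [Filter.eventually_all]; intro σ
    by_cases h : invWeight w σ < invWeight w σ₀
    · exact (small K _ (sub_pos.2 h)).mono fun ε hε _ => hε
    · simp [h]
  obtain ⟨ε, ⟨h1, h2⟩, hε⟩ := ((e1.and e2).and self_mem_nhdsWithin).exists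
  have hw' : IsWeight fun a b => w a b - ε * c a b :=
    ⟨fun a b => sub_nonneg.2 (h1 a b), fun a b => by rw [hw.symm, hc.weight.symm],
      fun a => by rw [hw.diag, hc.weight.diag]; ring⟩
  refine ⟨ε, hε, hw', fun M hM σ hσ => ?_⟩
  obtain ⟨τ, hτ, hsupp, heq⟩ := exists_supported hw hσ
  rw [← heq _ hw' fun a b h => by rw [h, hc.supp a b h]; ring, hlin]
  have hM₀ := hM σ₀ hσ₀
  have hε' : (0 : ℝ) < ε := hε
  rcases (hmax τ hτ).lt_or_eq with h | h
  · have h3 : 0 ≤ invWeight c τ := Finset.sum_nonneg fun a _ => hc.weight.nonneg _ _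
    have h4 := h2 τ h
    nlinarith [mul_nonneg hε'.le h3]
  · have h3 := hc.tight τ ⟨hτ, hsupp, fun θ hθ => h ▸ hmax θ hθ⟩
    nlinarith [mul_le_mul_of_nonneg_left h3 hε'.le]

theorem isCompact_weights : IsCompact {w : V → V → ℝ | IsWeight w ∧ ∑ a, ∑ b, w a b = 1} := by
  refine IsCompact.of_isClosed_subset
    (isCompact_univ_pi fun _ : V => isCompact_univ_pi fun _ : V => isCompact_Icc (a := (0 : ℝ))
      (b := 1)) ?_ ?_
  · have : {w : V → V → ℝ | IsWeight w ∧ ∑ a, ∑ b, w a b = 1}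
        = {w | ∀ a b, 0 ≤ w a b} ∩ {w | ∀ a b, w a b = w b a} ∩ {w | ∀ a, w a a = 0}
          ∩ {w | ∑ a, ∑ b, w a b = 1} := by
      ext w
      exact ⟨fun h => ⟨⟨⟨h.1.1, h.1.2⟩, h.1.3⟩, h.2⟩, fun h => ⟨⟨h.1.1.1, h.1.1.2, h.1.2⟩, h.2⟩⟩
    rw [this]
    simp only [Set.ofPred_forall]
    refine ((IsClosed.inter ?_ ?_).inter ?_).inter ?_
    · exact isClosed_iInter fun a => isClosed_iInter fun b =>
        isClosed_le continuous_const (by fun_prop)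
    · exact isClosed_iInter fun a => isClosed_iInter fun b =>
        isClosed_eq (by fun_prop) (by fun_prop)
    · exact isClosed_iInter fun a => isClosed_eq (by fun_prop) continuous_const
    · exact isClosed_eq (by fun_prop) continuous_const
  · rintro w ⟨hw, hsum⟩ a - b -
    refine ⟨hw.nonneg a b, ?_⟩
    rw [← hsum]
    exact (Finset.single_le_sum (f := w a) (fun b _ => hw.nonneg a b) (Finset.mem_univ b)).trans
      (Finset.single_le_sum (f := fun a => ∑ b, w a b)
        (fun a _ => Finset.sum_nonneg fun b _ => hw.nonneg a b) (Finset.mem_univ a))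

/-- The violation, a minimum over matchings, is continuous and positively homogeneous in the weight.
It attains its maximum on the compact set of weights of total 1, and scaling extends the bound to
all weights. -/
theorem exists_normalized_maximizer {x w₀ : V → V → ℝ} (hw₀ : IsWeight w₀)
    (h₀ : ∀ σ, Function.Involutive σ → invWeight w₀ σ < ∑ a, ∑ b, w₀ a b * x a b) :
    ∃ (w : V → V → ℝ) (m : ℝ), IsWeight w ∧ ∑ a, ∑ b, w a b = 1 ∧ 0 < m ∧
      (∀ σ, Function.Involutive σ → m ≤ ∑ a, ∑ b, w a b * x a b - invWeight w σ) ∧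
      ∀ w', IsWeight w' → ∃ σ, Function.Involutive σ ∧
        ∑ a, ∑ b, w' a b * x a b - invWeight w' σ ≤ m * ∑ a, ∑ b, w' a b := by
  classical
  have : Nonempty {σ : V → V // Function.Involutive σ} := ⟨⟨id, fun _ => rfl⟩⟩
  let g : (V → V → ℝ) → ℝ := fun w =>
    (Finset.univ : Finset {σ : V → V // Function.Involutive σ}).inf' Finset.univ_nonempty
      fun σ => ∑ a, ∑ b, w a b * x a b - invWeight w σ
  have hg : Continuous g := by
    refine Continuous.finset_inf'_apply _ fun σ _ => ?_
    unfold invWeight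
    fun_prop
  have hscale : ∀ (w : V → V → ℝ) (r : ℝ) σ,
      ∑ a, ∑ b, r * w a b * x a b - invWeight (fun a b => r * w a b) σ
        = r * (∑ a, ∑ b, w a b * x a b - invWeight w σ) := fun w r σ => by
    simp only [invWeight, Finset.mul_sum, mul_sub, mul_assoc]
  have hmem : ∀ w : V → V → ℝ, IsWeight w → 0 < ∑ a, ∑ b, w a b →
      (fun a b => (∑ a, ∑ b, w a b)⁻¹ * w a b) ∈
        {w : V → V → ℝ | IsWeight w ∧ ∑ a, ∑ b, w a b = 1} := fun w hw hpos =>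
    ⟨⟨fun a b => mul_nonneg (inv_nonneg.2 hpos.le) (hw.nonneg a b), fun a b => by rw [hw.symm],
      fun a => by rw [hw.diag, mul_zero]⟩, by
        simp only [← Finset.mul_sum]; exact inv_mul_cancel₀ hpos.ne'⟩
  have hzero : ∀ w : V → V → ℝ, IsWeight w → ¬ 0 < ∑ a, ∑ b, w a b → w = 0 := by
    intro w hw h
    have hn : ∀ a, 0 ≤ ∑ b, w a b := fun a => Finset.sum_nonneg fun b _ => hw.nonneg a b
    have h1 : ∑ a, ∑ b, w a b = 0 := le_antisymm (not_lt.1 h) (Finset.sum_nonneg fun a _ => hn a)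
    ext a b
    rw [Finset.sum_eq_zero_iff_of_nonneg fun a _ => hn a] at h1
    have h2 := h1 a (Finset.mem_univ a)
    rw [Finset.sum_eq_zero_iff_of_nonneg fun b _ => hw.nonneg a b] at h2
    exact h2 b (Finset.mem_univ b)
  have hpos₀ : 0 < ∑ a, ∑ b, w₀ a b := by
    by_contra h
    have := h₀ id fun _ => rfl
    rw [hzero w₀ hw₀ h] at this
    simp [invWeight] at this
  obtain ⟨w, ⟨hw, hsum⟩, hmax⟩ :=
    isCompact_weights.exists_isMaxOn ⟨_, hmem w₀ hw₀ hpos₀⟩ hg.continuousOn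
  refine ⟨w, g w, hw, hsum, ?_, fun σ hσ => ?_, fun w' hw' => ?_⟩
  · refine lt_of_lt_of_le ?_ (hmax (hmem w₀ hw₀ hpos₀))
    refine (Finset.lt_inf'_iff _).2 fun σ _ => ?_
    rw [hscale]
    exact mul_pos (inv_pos.2 hpos₀) (sub_pos.2 (h₀ σ σ.2))
  · exact Finset.inf'_le (f := fun σ : {σ : V → V // Function.Involutive σ} =>
      ∑ a, ∑ b, w a b * x a b - invWeight w σ) (Finset.mem_univ ⟨σ, hσ⟩)
  · by_cases hpos : 0 < ∑ a, ∑ b, w' a b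
    · have h : g _ ≤ g w := hmax (hmem w' hw' hpos)
      obtain ⟨σ, -, hσ⟩ := Finset.inf'_le_iff (Finset.univ_nonempty) |>.1 h
      refine ⟨σ, σ.2, ?_⟩
      rw [hscale, inv_mul_le_iff₀ hpos] at hσ
      linarith
    · refine ⟨id, fun _ => rfl, ?_⟩
      rw [hzero w' hw' hpos]
      simp [invWeight]

/-- Edmonds' matching polytope theorem: a linear functional on a fractional matching is at most
its maximum over matchings. -/
theorem IsFracMatching.exists_involutive_le {x w : V → V → ℝ} (hx : IsFracMatching x)
    (hw : IsWeight w) :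
    ∃ σ, Function.Involutive σ ∧ ∑ a, ∑ b, w a b * x a b ≤ invWeight w σ := by
  by_contra! hcon
  obtain ⟨w₁, m, hw₁, hsum, hm, hle, hmax⟩ := exists_normalized_maximizer hw hcon
  obtain ⟨u, v, huv⟩ : ∃ u v, 0 < w₁ u v := by
    by_contra! h
    have : ∑ a, ∑ b, w₁ a b ≤ 0 := Finset.sum_nonpos fun a _ => Finset.sum_nonpos fun b _ => h a b
    linarith
  obtain ⟨c, K, hc⟩ := exists_tightInequality hw₁ huv
  obtain ⟨ε, hε, hw', hbound⟩ := hc.exists_perturbation hw₁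
  obtain ⟨σ, hσ, hσm⟩ := hmax _ hw'
  -- The perturbed weight still has violation at least m, because c·x ≤ K, but its total is strictly
  -- below 1. This contradicts the maximality of m.
  have h1 := hbound (∑ a, ∑ b, w₁ a b * x a b - m) (fun τ hτ => by linarith [hle τ hτ]) σ hσ
  have h2 : ∑ a, ∑ b, (w₁ a b - ε * c a b) * x a b
      = ∑ a, ∑ b, w₁ a b * x a b - ε * ∑ a, ∑ b, c a b * x a b := by
    simp only [sub_mul, Finset.sum_sub_distrib, Finset.mul_sum, mul_assoc]
  have h3 : ∑ a, ∑ b, (w₁ a b - ε * c a b) = 1 - ε * ∑ a, ∑ b, c a b := by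
    simp only [Finset.sum_sub_distrib, Finset.mul_sum, hsum]
  have h4 : 0 < ∑ a, ∑ b, c a b := by
    obtain ⟨p, q, hpq⟩ := hc.ne_zero
    have hn : ∀ a, 0 ≤ ∑ b, c a b := fun a => Finset.sum_nonneg fun b _ => hc.weight.nonneg a b
    refine Finset.sum_pos' (fun a _ => hn a) ⟨p, Finset.mem_univ p, ?_⟩
    exact Finset.sum_pos' (fun b _ => hc.weight.nonneg p b) ⟨q, Finset.mem_univ q, hpq⟩
  have h5 := mul_le_mul_of_nonneg_left (hc.valid x hx) hε.le
  rw [h2, h3] at hσm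
  nlinarith [mul_pos hm (mul_pos hε h4)]

end Matching

/-! ### Maximum flows and minimum cuts. -/

section Flow

variable {V : Type*} [Fintype V]

/-- Net flow out of `v`, where `F j i` is the flow from `i` to `j`. -/
def netOut (F : V → V → ℝ) (v : V) : ℝ := ∑ j, F j v - ∑ k, F v k

/-- Flows from `s` to `t` obeying the capacities `c`. -/
structure IsFlow (c : V → V → ℝ) (s t : V) (F : V → V → ℝ) : Prop where
  nonneg : ∀ j i, 0 ≤ F j i
  le_cap : ∀ j i, F j i ≤ c j i
  conserved : ∀ v, v ≠ s → v ≠ t → netOut F v = 0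

theorem sum_netOut [DecidableEq V] (F : V → V → ℝ) (Ω : Finset V) :
    ∑ v ∈ Ω, netOut F v = ∑ i ∈ Ω, ∑ j ∈ Ωᶜ, (F j i - F i j) := by
  have h : ∀ f : V → ℝ, ∑ j, f j = ∑ j ∈ Ω, f j + ∑ j ∈ Ωᶜ, f j := fun f =>
    (Finset.sum_add_sum_compl Ω f).symm
  simp only [netOut, h, Finset.sum_sub_distrib, Finset.sum_add_distrib]
  rw [Finset.sum_comm (s := Ω) (t := Ω)]
  ring

theorem IsFlow.netOut_eq_cut [DecidableEq V] {c F : V → V → ℝ} {s t : V} (hF : IsFlow c s t F)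
    {Ω : Finset V} (hs : s ∈ Ω) (ht : t ∉ Ω) :
    netOut F s = ∑ i ∈ Ω, ∑ j ∈ Ωᶜ, (F j i - F i j) := by
  rw [← sum_netOut]
  refine (Finset.sum_eq_single_of_mem s hs fun v hv hvs => hF.conserved v hvs ?_).symm
  rintro rfl
  exact ht hv

theorem IsFlow.netOut_le_cut [DecidableEq V] {c F : V → V → ℝ} {s t : V} (hF : IsFlow c s t F)
    {Ω : Finset V} (hs : s ∈ Ω) (ht : t ∉ Ω) :
    netOut F s ≤ ∑ i ∈ Ω, ∑ j ∈ Ωᶜ, c j i := by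
  rw [hF.netOut_eq_cut hs ht]
  refine Finset.sum_le_sum fun i _ => Finset.sum_le_sum fun j _ => ?_
  linarith [hF.nonneg i j, hF.le_cap j i]

theorem isCompact_flows (c : V → V → ℝ) (s t : V) : IsCompact {F | IsFlow c s t F} := by
  refine IsCompact.of_isClosed_subset
    (isCompact_univ_pi fun j : V => isCompact_univ_pi fun i : V => isCompact_Icc (a := (0 : ℝ))
      (b := c j i)) ?_ fun F hF j _ i _ => ⟨hF.nonneg j i, hF.le_cap j i⟩
  have : {F | IsFlow c s t F} = {F | ∀ j i, 0 ≤ F j i} ∩ {F | ∀ j i, F j i ≤ c j i} ∩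
      {F | ∀ v, v ≠ s → v ≠ t → netOut F v = 0} := by
    ext F
    exact ⟨fun h => ⟨⟨h.1, h.2⟩, h.3⟩, fun h => ⟨h.1.1, h.1.2, h.2⟩⟩
  rw [this]
  simp only [Set.ofPred_forall, netOut]
  refine (IsClosed.inter ?_ ?_).inter ?_
  · exact isClosed_iInter fun a => isClosed_iInter fun b =>
      isClosed_le continuous_const (by fun_prop)
  · exact isClosed_iInter fun a => isClosed_iInter fun b =>
      isClosed_le (by fun_prop) continuous_const
  · exact isClosed_iInter fun a => isClosed_iInter fun _ => isClosed_iInter fun _ =>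
      isClosed_eq (by fun_prop) continuous_const

/-- Directions along which a flow can be moved without violating the capacities. -/
structure IsAugmenting (c F G : V → V → ℝ) : Prop where
  le_of_full : ∀ j i, F j i = c j i → G j i ≤ 0
  nonneg_of_zero : ∀ j i, F j i = 0 → 0 ≤ G j i

theorem netOut_add (F G : V → V → ℝ) (r : ℝ) (v : V) :
    netOut (fun j i => F j i + r * G j i) v = netOut F v + r * netOut G v := by
  simp only [netOut, Finset.sum_add_distrib, ← Finset.mul_sum]
  ring

/-- Each residual step adds one unit on an unsaturated link or removes one unit from a link carrying
flow; both sign conditions survive such additions. -/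
theorem exists_augmenting [DecidableEq V] {c F : V → V → ℝ} {s v : V}
    (hv : Relation.ReflTransGen (fun a b => F b a < c b a ∨ 0 < F a b) s v) :
    ∃ G, IsAugmenting c F G ∧ netOut G = Pi.single s 1 - Pi.single v 1 := by
  induction hv with
  | refl => exact ⟨0, ⟨fun _ _ _ => le_rfl, fun _ _ _ => le_rfl⟩, by ext; simp [netOut]⟩
  | @tail a b _ hab ih =>
    obtain ⟨G, hG, hGs⟩ := ih
    have key : ∀ (p q : V) (r : ℝ), netOut (fun j i => G j i +
        r * (if j = q ∧ i = p then 1 else 0))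
          = netOut G + r • (Pi.single p 1 - Pi.single q 1) := by
      intro p q r
      ext v
      rw [netOut_add]
      simp [netOut, ite_and, Pi.single_apply]
    rcases hab with h | h
    · refine ⟨fun j i => G j i + 1 * (if j = b ∧ i = a then 1 else 0),
        ⟨fun j i hji => ?_, fun j i hji => ?_⟩, ?_⟩
      · have hne : ¬ (j = b ∧ i = a) := by rintro ⟨rfl, rfl⟩; exact h.ne hji
        simpa [hne] using hG.le_of_full j i hji
      · have := hG.nonneg_of_zero j i hji
        positivity
      · rw [key, hGs]; simp
    · refine ⟨fun j i => G j i + (-1) * (if j = a ∧ i = b then 1 else 0),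
        ⟨fun j i hji => ?_, fun j i hji => ?_⟩, ?_⟩
      · have := hG.le_of_full j i hji
        split_ifs <;> linarith
      · have hne : ¬ (j = a ∧ i = b) := by rintro ⟨rfl, rfl⟩; exact h.ne' hji
        simpa [hne] using hG.nonneg_of_zero j i hji
      · rw [key, hGs]; simp

theorem IsFlow.exists_netOut_lt [DecidableEq V] {c F G : V → V → ℝ} {s t : V} (hst : s ≠ t)
    (hF : IsFlow c s t F) (hG : IsAugmenting c F G)
    (hGs : netOut G = Pi.single s 1 - Pi.single t 1) :
    ∃ F', IsFlow c s t F' ∧ netOut F s < netOut F' s := by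
  have small : ∀ p q : ℝ, 0 ≤ q → (q = 0 → 0 ≤ p) →
      ∀ᶠ ε in nhdsWithin (0 : ℝ) (Set.Ioi 0), 0 ≤ q + ε * p := by
    intro p q hq hp
    rcases hq.eq_or_lt with h | h
    · filter_upwards [self_mem_nhdsWithin] with ε hε
      rw [← h, zero_add]
      exact mul_nonneg (le_of_lt hε) (hp h.symm)
    · have hc : Continuous fun ε : ℝ => q + ε * p := by fun_prop
      have : Filter.Tendsto (fun ε : ℝ => q + ε * p) (nhdsWithin 0 (Set.Ioi 0)) (nhds q) := by
        simpa using (hc.tendsto 0).mono_left nhdsWithin_le_nhds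
      exact (this.eventually (lt_mem_nhds h)).mono fun _ h => le_of_lt h
  have e1 : ∀ᶠ ε in nhdsWithin (0 : ℝ) (Set.Ioi 0), ∀ j i, 0 ≤ F j i + ε * G j i := by
    rw [Filter.eventually_all]; intro j
    rw [Filter.eventually_all]; intro i
    exact small _ _ (hF.nonneg j i) (hG.nonneg_of_zero j i)
  have e2 : ∀ᶠ ε in nhdsWithin (0 : ℝ) (Set.Ioi 0), ∀ j i,
      0 ≤ (c j i - F j i) + ε * (-G j i) := by
    rw [Filter.eventually_all]; intro j
    rw [Filter.eventually_all]; intro i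
    refine small _ _ (sub_nonneg.2 (hF.le_cap j i)) fun h => ?_
    have := hG.le_of_full j i (by linarith)
    linarith
  obtain ⟨ε, ⟨h1, h2⟩, hε⟩ := ((e1.and e2).and self_mem_nhdsWithin).exists
  refine ⟨fun j i => F j i + ε * G j i, ⟨h1, fun j i => by linarith [h2 j i], fun v hs ht => ?_⟩, ?_⟩
  · rw [netOut_add, hF.conserved v hs ht, hGs]
    simp [hs, ht]
  · rw [netOut_add, hGs]
    have hε' : (0 : ℝ) < ε := hε
    simp [hst, hε']

/-- The max-flow min-cut theorem. -/
theorem exists_flow_eq_cut [DecidableEq V] {c : V → V → ℝ} (hc : ∀ j i, 0 ≤ c j i) {s t : V}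
    (hst : s ≠ t) :
    ∃ F, IsFlow c s t F ∧ ∃ Ω : Finset V, s ∈ Ω ∧ t ∉ Ω ∧
      netOut F s = ∑ i ∈ Ω, ∑ j ∈ Ωᶜ, c j i := by
  classical
  have hcont : Continuous fun F : V → V → ℝ => netOut F s := by unfold netOut; fun_prop
  obtain ⟨F, hF, hmax⟩ := (isCompact_flows c s t).exists_isMaxOn
    ⟨0, fun _ _ => le_rfl, hc, fun v _ _ => by simp [netOut]⟩ hcont.continuousOn
  change IsFlow c s t F at hF
  let R : V → V → Prop := fun a b => F b a < c b a ∨ 0 < F a b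
  -- The vertices reachable in the residual graph form the cut: links leaving it are saturated and
  -- links entering it are empty. Reaching `t` would contradict maximality.
  let Ω : Finset V := {v | Relation.ReflTransGen R s v}
  have hmem : ∀ v, v ∈ Ω ↔ Relation.ReflTransGen R s v := fun v => by simp [Ω]
  have hs : s ∈ Ω := (hmem s).2 .refl
  have ht : t ∉ Ω := by
    intro h
    obtain ⟨G, hG, hGs⟩ := exists_augmenting ((hmem t).1 h)
    obtain ⟨F', hF', hlt⟩ := hF.exists_netOut_lt hst hG hGs
    exact hlt.not_ge (hmax hF')
  refine ⟨F, hF, Ω, hs, ht, ?_⟩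
  rw [hF.netOut_eq_cut hs ht]
  refine Finset.sum_congr rfl fun i hi => Finset.sum_congr rfl fun j hj => ?_
  rw [hmem] at hi
  rw [Finset.mem_compl, hmem] at hj
  have hR : ¬ R i j := fun h => hj (hi.tail h)
  simp only [R, not_or, not_lt] at hR
  linarith [hF.nonneg i j, hF.le_cap j i, hR.1, hR.2]

end Flow

/-! ### Sums over pairs i < j as symmetric double sums. -/

section PairSums

variable {V : Type*} [Fintype V] [LinearOrder V]

theorem two_mul_sum_lt {Y : V → V → ℝ} (hY : ∀ a b, Y a b = Y b a) (hd : ∀ a, Y a a = 0)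
    (Q : V × V → Prop) [DecidablePred Q] (hQ : ∀ p, Q p.swap ↔ Q p) :
    2 * ∑ p : V × V with Q p ∧ p.1 < p.2, Y p.1 p.2 = ∑ p : V × V with Q p, Y p.1 p.2 := by
  have h1 : ∑ p : V × V with Q p ∧ p.1 < p.2, Y p.1 p.2
      = ∑ p : V × V with Q p ∧ p.2 < p.1, Y p.1 p.2 := by
    refine Finset.sum_equiv (Equiv.prodComm V V) (fun p => ?_) (fun p _ => hY _ _)
    have := hQ p
    simp only [Finset.mem_filter, Finset.mem_univ, true_and, Equiv.prodComm_apply, Prod.fst_swap,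
      Prod.snd_swap, this]
  rw [two_mul]
  nth_rewrite 2 [h1]
  simp only [Finset.sum_filter, ← Finset.sum_add_distrib]
  refine Finset.sum_congr rfl fun p _ => ?_
  rcases lt_trichotomy p.1 p.2 with h | h | h
  · simp [h, h.not_gt]
  · simp [h, hd]
  · simp [h, h.not_gt]

theorem sum_incident_lt {Y : V → V → ℝ} (hY : ∀ a b, Y a b = Y b a) (hd : ∀ a, Y a a = 0)
    (v : V) : ∑ p : V × V with (p.1 = v ∨ p.2 = v) ∧ p.1 < p.2, Y p.1 p.2 = ∑ b, Y v b := by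
  have h := two_mul_sum_lt hY hd (fun p => p.1 = v ∨ p.2 = v) fun p => by simp [or_comm]
  have h2 : ∑ p : V × V with p.1 = v ∨ p.2 = v, Y p.1 p.2 = ∑ b, Y v b + ∑ b, Y b v := by
    rw [Finset.sum_filter, Fintype.sum_prod_type]
    have : ∀ a b, (if a = v ∨ b = v then Y a b else 0)
        = (if a = v then Y a b else 0) + (if b = v then Y a b else 0) := by
      intro a b
      by_cases ha : a = v <;> by_cases hb : b = v <;> simp [ha, hb, hd]
    simp only [this, Finset.sum_add_distrib]
    congr 1
    · rw [Finset.sum_comm]; simp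
    · simp
  have h3 : ∑ b, Y b v = ∑ b, Y v b := Finset.sum_congr rfl fun b _ => hY b v
  linarith

theorem two_mul_sum_inside_lt {Y : V → V → ℝ} (hY : ∀ a b, Y a b = Y b a) (hd : ∀ a, Y a a = 0)
    (S : Finset V) :
    2 * ∑ p : V × V with p.1 ∈ S ∧ p.2 ∈ S ∧ p.1 < p.2, Y p.1 p.2 = ∑ a ∈ S, ∑ b ∈ S, Y a b := by
  have h := two_mul_sum_lt hY hd (fun p => p.1 ∈ S ∧ p.2 ∈ S) fun p => by simp [and_comm]
  simp only [and_assoc] at h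
  rw [h, ← Finset.sum_product']
  refine Finset.sum_congr ?_ fun _ _ => rfl
  ext p
  simp

end PairSums

theorem IsFracMatching.mono {V : Type*} [Fintype V] {x y : V → V → ℝ} (hy : IsFracMatching y)
    (h0 : ∀ a b, 0 ≤ x a b) (hsymm : ∀ a b, x a b = x b a) (hle : ∀ a b, x a b ≤ y a b) :
    IsFracMatching x where
  nonneg := h0
  symm := hsymm
  degree a := (Finset.sum_le_sum fun b _ => hle a b).trans (hy.degree a)
  odd_set S hS :=
    (Finset.sum_le_sum fun a _ => Finset.sum_le_sum fun b _ => hle a b).trans (hy.odd_set S hS)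

theorem IsFracMatching.sum {V ι : Type*} [Fintype V] [Fintype ι] {x : ι → V → V → ℝ}
    (hx : ∀ s, IsFracMatching (x s)) {r : ι → ℝ} (hr : ∀ s, 0 ≤ r s) (hr1 : ∑ s, r s = 1) :
    IsFracMatching fun a b => ∑ s, r s * x s a b where
  nonneg a b := Finset.sum_nonneg fun s _ => mul_nonneg (hr s) ((hx s).nonneg a b)
  symm a b := Finset.sum_congr rfl fun s _ => by rw [(hx s).symm]
  degree a := by
    rw [Finset.sum_comm, ← hr1]
    refine Finset.sum_le_sum fun s _ => ?_
    rw [← Finset.mul_sum]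
    exact mul_le_of_le_one_right (hr s) ((hx s).degree a)
  odd_set S hS := by
    have : ∀ a, ∑ b ∈ S, ∑ s, r s * x s a b = ∑ s, ∑ b ∈ S, r s * x s a b :=
      fun a => Finset.sum_comm
    simp only [this]
    rw [Finset.sum_comm]
    calc _ ≤ ∑ s, r s * (S.card - 1 : ℝ) := by
          refine Finset.sum_le_sum fun s _ => ?_
          simp only [← Finset.mul_sum]
          exact mul_le_mul_of_nonneg_left ((hx s).odd_set S hS) (hr s)
      _ = S.card - 1 := by rw [← Finset.sum_mul, hr1, one_mul]

/-! ### States as oriented matchings, schedules as fractional matchings. -/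

variable {N : ℕ}

/-- The links that a state can activate. -/
def IsLink (j i : Node N) : Prop := i ≠ dst N ∧ j ≠ src N ∧ j ≠ i

/-- The indicator that a state activates the link from `i` to `j`. -/
def State.link (s : State N) (j i : Node N) : ℝ := if j ∈ s.tx i ∧ i ∈ s.rx j then 1 else 0

theorem State.link_nonneg (s : State N) (j i : Node N) : 0 ≤ s.link j i := by
  unfold State.link; positivity

theorem State.link_eq_zero (s : State N) {j i : Node N} (h : ¬ IsLink j i) : s.link j i = 0 := by
  refine if_neg fun ⟨hj, hi⟩ => h ⟨(s.rx_range j i hi).1, s.tx_range i j hj⟩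

theorem activation_eq_sum_link (lam : State N → ℝ) (j i : Node N) :
    activation lam j i = ∑ s, lam s * s.link j i := by
  simp [activation, State.link, Finset.sum_filter]

theorem activation_eq_zero (lam : State N → ℝ) {j i : Node N} (h : ¬ IsLink j i) :
    activation lam j i = 0 := by
  simp [activation_eq_sum_link, State.link_eq_zero _ h]

theorem IsSchedule.activation_nonneg {lam : State N → ℝ} (hlam : IsSchedule lam) (j i : Node N) :
    0 ≤ activation lam j i :=
  Finset.sum_nonneg fun s _ => hlam.1 s

theorem State.degree_le (s : State N) (v : Node N) (S : Finset (Node N)) :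
    (S.filter fun u => v ∈ s.tx u ∧ u ∈ s.rx v).card
      + (S.filter fun u => u ∈ s.tx v ∧ v ∈ s.rx u).card ≤ 1 := by
  have h1 : (S.filter fun u => v ∈ s.tx u ∧ u ∈ s.rx v) ⊆ s.rx v := fun u hu =>
    (Finset.mem_filter.1 hu).2.2
  have h2 : (S.filter fun u => u ∈ s.tx v ∧ v ∈ s.rx u) ⊆ s.tx v := fun u hu =>
    (Finset.mem_filter.1 hu).2.1
  have h3 := s.half_duplex v
  have := Finset.card_le_card h1
  have := Finset.card_le_card h2
  omega

theorem State.isFracMatching (s : State N) :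
    IsFracMatching fun a b => s.link a b + s.link b a where
  nonneg a b := add_nonneg (s.link_nonneg a b) (s.link_nonneg b a)
  symm a b := add_comm _ _
  degree a := by
    have h := s.degree_le a Finset.univ
    simp only [State.link, Finset.sum_add_distrib, Finset.sum_boole]
    exact_mod_cast h
  odd_set S hS := by
    have h1 : ∑ a ∈ S, ((S.filter fun u => a ∈ s.tx u ∧ u ∈ s.rx a).card
      + (S.filter fun u => u ∈ s.tx a ∧ a ∈ s.rx u).card) ≤ S.card := by
      refine (Finset.sum_le_sum fun a _ => s.degree_le a S).trans ?_
      simp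
    have h2 : ∑ a ∈ S, (S.filter fun u => a ∈ s.tx u ∧ u ∈ s.rx a).card
        = ∑ a ∈ S, (S.filter fun u => u ∈ s.tx a ∧ a ∈ s.rx u).card := by
      simp only [Finset.card_filter]
      exact Finset.sum_comm
    rw [Finset.sum_add_distrib, h2, ← two_mul] at h1
    -- Inside `S`, incoming and outgoing links are equally many, so the total is even; being at most
    -- the odd number |S|, it is at most |S| - 1.
    have h3 : ∑ a ∈ S, (S.filter fun u => u ∈ s.tx a ∧ a ∈ s.rx u).card +
        ∑ a ∈ S, (S.filter fun u => u ∈ s.tx a ∧ a ∈ s.rx u).card + 1 ≤ S.card := by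
      obtain ⟨k, hk⟩ := hS
      omega
    simp only [State.link, Finset.sum_add_distrib, Finset.sum_boole]
    rw [le_sub_iff_add_le]
    rw [← h2] at h3
    nth_rewrite 2 [h2] at h3
    exact_mod_cast h3

theorem IsSchedule.isFracMatching {lam : State N → ℝ} (hlam : IsSchedule lam) :
    IsFracMatching fun a b => activation lam a b + activation lam b a := by
  have h := IsFracMatching.sum (fun s : State N => s.isFracMatching) hlam.1 hlam.2
  simpa only [activation_eq_sum_link, mul_add, Finset.sum_add_distrib] using h

/-- A matching can be oriented into a state that serves the heavier direction of each edge. -/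
theorem exists_state_of_involutive {w : Node N → Node N → ℝ} (hw : ∀ j i, 0 ≤ w j i)
    (hw0 : ∀ j i, ¬ IsLink j i → w j i = 0) {σ : Node N → Node N}
    (hσ : Function.Involutive σ) :
    ∃ s : State N, invWeight (fun i j => max (w i j) (w j i)) σ
      ≤ 2 * ∑ j, ∑ i, w j i * s.link j i := by
  classical
  -- `T i` says that `i` transmits to its partner: its direction is heavier, ties being broken by
  -- the node order. If the preferred direction is not a link, its weight is zero and nothing is
  -- lost.
  let T : Node N → Prop := fun i => IsLink (σ i) i ∧
    (w i (σ i) < w (σ i) i ∨ (w i (σ i) = w (σ i) i ∧ i < σ i))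
  have hT : ∀ i, ¬ (T i ∧ T (σ i)) := by
    rintro i ⟨⟨-, h1⟩, -, h2⟩
    rw [hσ i] at h2
    rcases h1 with h1 | ⟨h1, h1'⟩ <;> rcases h2 with h2 | ⟨h2, h2'⟩
    · exact lt_asymm h1 h2
    · exact h1.ne' h2
    · exact h2.ne' h1
    · exact lt_asymm h1' h2'
  let s : State N :=
    { tx := fun i => if T i then {σ i} else ∅
      rx := fun i => if T (σ i) then {σ i} else ∅
      tx_range := fun i j hj => by
        split_ifs at hj with h
        · rw [Finset.mem_singleton] at hj
          exact hj ▸ h.1.2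
        · simp at hj
      rx_range := fun i j hj => by
        split_ifs at hj with h
        · rw [Finset.mem_singleton] at hj
          have h1 := h.1.2.2
          rw [hσ i] at h1
          exact hj ▸ ⟨h.1.1, h1.symm⟩
        · simp at hj
      tx_card := fun i => by split_ifs <;> simp
      rx_card := fun i => by split_ifs <;> simp
      half_duplex := fun i => by
        have := hT i
        by_cases h1 : T i <;> by_cases h2 : T (σ i) <;> simp_all
      src_rx := if_neg fun h => h.1.2.1 (hσ _)
      dst_tx := if_neg fun h => h.1.1 rfl }
  have hlink : ∀ j i, s.link j i = if j = σ i then (if T i then 1 else 0) else 0 := by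
    intro j i
    by_cases hj : j = σ i
    · subst hj
      by_cases h : T i
      · have : σ (σ i) = i := hσ i
        simp [State.link, s, h, this]
      · simp [State.link, s, h]
    · have : j ∉ s.tx i := by
        by_cases h : T i <;> simp [s, h, hj]
      simp [State.link, this, hj]
  refine ⟨s, ?_⟩
  have hsum : ∑ j, ∑ i, w j i * s.link j i = ∑ i, (if T i then w (σ i) i else 0) := by
    rw [Finset.sum_comm]
    refine Finset.sum_congr rfl fun i _ => ?_
    simp [hlink]
  -- Reindexing by σ credits each edge to its receiver as well, matching the double count in
  -- `invWeight`.
  have hflip : ∑ i, (if T i then w (σ i) i else 0)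
      = ∑ i, (if T (σ i) then w i (σ i) else 0) := by
    rw [← Equiv.sum_comp hσ.toPerm]
    refine Finset.sum_congr rfl fun i _ => ?_
    simp [hσ i]
  rw [hsum, two_mul]
  nth_rewrite 2 [hflip]
  rw [← Finset.sum_add_distrib]
  refine Finset.sum_le_sum fun i _ => ?_
  have hnn : ∀ i, 0 ≤ if T i then w (σ i) i else 0 := fun i => by
    split_ifs; exacts [hw _ _, le_rfl]
  have hT' : ∀ i, w i (σ i) < w (σ i) i ∨ (w i (σ i) = w (σ i) i ∧ i < σ i) →
      w (σ i) i ≤ if T i then w (σ i) i else 0 := by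
    intro i hi
    by_cases hl : IsLink (σ i) i
    · rw [if_pos ⟨hl, hi⟩]
    · exact (hw0 _ _ hl).trans_le (hnn i)
  have e1 := hnn i
  have e2 := hnn (σ i)
  have e3 := hT' i
  have e4 := hT' (σ i)
  simp only [hσ i] at e2 e4
  rcases lt_trichotomy (w i (σ i)) (w (σ i) i) with h | h | h
  · have := e3 (.inl h)
    exact max_le (by linarith) (by linarith)
  · rcases lt_trichotomy i (σ i) with h' | h' | h'
    · have := e3 (.inr ⟨h, h'⟩)
      exact max_le (by linarith) (by linarith)
    · have : w (σ i) i = 0 := hw0 _ _ fun hl => hl.2.2 h'.symm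
      exact max_le (by linarith) (by linarith)
    · have := e4 (.inr ⟨h.symm, h'⟩)
      exact max_le (by linarith) (by linarith)
  · have := e4 (.inl h)
    exact max_le (by linarith) (by linarith)

/-- Replacing both directions of an edge by the larger weight reduces the directed problem to
Edmonds' theorem; orienting the resulting matching loses nothing. -/
theorem exists_state_weight_ge {a w : Node N → Node N → ℝ} (ha : ∀ j i, 0 ≤ a j i)
    (ha0 : ∀ j i, ¬ IsLink j i → a j i = 0) (hX : IsFracMatching fun i j => a i j + a j i)
    (hw : ∀ j i, 0 ≤ w j i) :
    ∃ s : State N, ∑ j, ∑ i, w j i * a j i ≤ ∑ j, ∑ i, w j i * s.link j i := by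
  classical
  let u : Node N → Node N → ℝ := fun j i => if IsLink j i then w j i else 0
  have hu : ∀ j i, 0 ≤ u j i := fun j i => by
    by_cases h : IsLink j i <;> simp [u, h, hw j i]
  have huw : ∀ j i, u j i ≤ w j i := fun j i => by
    by_cases h : IsLink j i <;> simp [u, h, hw j i]
  have hu0 : ∀ j i, ¬ IsLink j i → u j i = 0 := fun j i h => if_neg h
  obtain ⟨σ, hσ, hle⟩ := hX.exists_involutive_le (w := fun i j => max (u i j) (u j i))
    ⟨fun i j => le_max_of_le_left (hu i j), fun i j => max_comm _ _,
      fun i => by rw [max_self]; exact hu0 _ _ fun h => h.2.2 rfl⟩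
  obtain ⟨s, hs⟩ := exists_state_of_involutive hu hu0 hσ
  refine ⟨s, ?_⟩
  have h1 : ∑ j, ∑ i, w j i * a j i = ∑ j, ∑ i, u j i * a j i := by
    refine Finset.sum_congr rfl fun j _ => Finset.sum_congr rfl fun i _ => ?_
    by_cases h : IsLink j i
    · simp [u, h]
    · simp [ha0 _ _ h]
  have h2 : 2 * ∑ j, ∑ i, u j i * a j i
      ≤ ∑ i, ∑ j, max (u i j) (u j i) * (a i j + a j i) := by
    have h3 : ∑ j, ∑ i, u j i * a j i = ∑ j, ∑ i, u i j * a i j := Finset.sum_comm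
    rw [two_mul]
    nth_rewrite 2 [h3]
    simp only [← Finset.sum_add_distrib]
    refine Finset.sum_le_sum fun i _ => Finset.sum_le_sum fun j _ => ?_
    rw [mul_add]
    exact add_le_add (mul_le_mul_of_nonneg_right (le_max_left _ _) (ha _ _))
      (mul_le_mul_of_nonneg_right (le_max_right _ _) (ha _ _))
  have h4 : ∑ j, ∑ i, u j i * s.link j i ≤ ∑ j, ∑ i, w j i * s.link j i :=
    Finset.sum_le_sum fun j _ => Finset.sum_le_sum fun i _ =>
      mul_le_mul_of_nonneg_right (huw j i) (s.link_nonneg j i)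
  linarith

theorem isSchedule_iff (lam : State N → ℝ) : IsSchedule lam ↔ lam ∈ stdSimplex ℝ (State N) :=
  Iff.rfl

theorem continuous_activation :
    Continuous fun (lam : State N → ℝ) (j i : Node N) => activation lam j i := by
  unfold activation
  fun_prop

theorem isSchedule_single [DecidableEq (State N)] (s : State N) :
    IsSchedule (Pi.single s 1 : State N → ℝ) :=
  single_mem_stdSimplex ℝ s

/-- Activation times that satisfy the matching constraints are dominated by those of a schedule. -/
theorem exists_schedule_activation_ge {a : Node N → Node N → ℝ} (ha : ∀ j i, 0 ≤ a j i)
    (ha0 : ∀ j i, ¬ IsLink j i → a j i = 0) (hX : IsFracMatching fun i j => a i j + a j i) :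
    ∃ lam : State N → ℝ, IsSchedule lam ∧ ∀ j i, a j i ≤ activation lam j i := by
  classical
  by_contra! hcon
  let act : (State N → ℝ) →ₗ[ℝ] (Node N → Node N → ℝ) :=
    { toFun := fun lam j i => activation lam j i
      map_add' := fun x y => by ext; simp [activation, Finset.sum_add_distrib]
      map_smul' := fun r x => by ext; simp [activation, Finset.mul_sum] }
  -- The achievable activation times form a compact convex set, to be separated from the orthant
  -- above `a`. The separating functional has nonnegative coefficients, so a single state
  -- contradicts the separation.
  obtain ⟨f, u, v, hfu, huv, hfv⟩ := geometric_hahn_banach_compact_closed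
    (s := act '' stdSimplex ℝ (State N)) (t := Set.Ici a)
    ((convex_stdSimplex ℝ _).linear_image act)
    ((isCompact_stdSimplex ℝ _).image continuous_activation)
    (convex_Ici a) isClosed_Ici (by
      rw [Set.disjoint_left]
      rintro _ ⟨lam, hlam, rfl⟩ hle
      obtain ⟨j, i, h⟩ := hcon lam hlam
      exact absurd (hle j i) (not_le.2 h))
  let w : Node N → Node N → ℝ := fun j i => f (Pi.single j (Pi.single i 1))
  have hf : ∀ y : Node N → Node N → ℝ, f y = ∑ j, ∑ i, w j i * y j i := by
    intro y
    have hy : y = ∑ j, ∑ i, y j i • (Pi.single j (Pi.single i 1) : Node N → Node N → ℝ) := by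
      ext p q
      simp [Finset.sum_apply, Pi.single_apply, ite_apply]
    conv_lhs => rw [hy]
    simp only [map_sum, map_smul, smul_eq_mul, mul_comm, w]
  have hw : ∀ j i, 0 ≤ w j i := by
    intro j i
    by_contra! hneg
    have hva : v < f a := hfv a Set.self_mem_Ici
    -- This step length along a coordinate of negative coefficient brings `f` down to exactly `v`,
    -- while staying in the orthant.
    have hr : 0 ≤ (f a - v) / (-w j i) := div_nonneg (by linarith) (by linarith)
    have h := hfv (a + ((f a - v) / (-w j i)) •
      (Pi.single j (Pi.single i 1) : Node N → Node N → ℝ)) (by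
      rw [Set.mem_Ici, le_add_iff_nonneg_right]
      refine smul_nonneg hr ?_
      rw [Pi.single_nonneg, Pi.single_nonneg]
      exact zero_le_one)
    rw [map_add, map_smul, smul_eq_mul] at h
    change v < f a + (f a - v) / (-w j i) * w j i at h
    rw [div_neg, neg_mul, div_mul_cancel₀ _ hneg.ne] at h
    linarith
  obtain ⟨s, hs⟩ := exists_state_weight_ge ha ha0 hX hw
  have h1 := hfu _ ⟨_, isSchedule_single s, rfl⟩
  have h2 : act (Pi.single s 1) = s.link := by
    ext j i
    simp [act, activation_eq_sum_link, Pi.single_apply]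
  have h3 := hfv a Set.self_mem_Ici
  rw [h2, hf] at h1
  rw [hf] at h3
  linarith

/-! ### Comparison of the best min-cut with P1. -/

variable {N : ℕ}

theorem linkCap_nonneg (h : Node N → Node N → ℂ) {P : ℝ} (hP : 0 ≤ P) (j i : Node N) :
    0 ≤ linkCap h P j i :=
  Real.log_nonneg (by nlinarith [mul_nonneg hP (sq_nonneg ‖h j i‖)])

theorem src_ne_dst (N : ℕ) : src N ≠ dst N := (Fin.last_pos' (n := N + 1)).ne

instance (N : ℕ) : Nonempty (Cut N) :=
  ⟨⟨{src N}, by simp, by simp⟩⟩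

theorem continuous_minCut (h : Node N → Node N → ℂ) (P : ℝ) :
    Continuous (minCut h P : (State N → ℝ) → ℝ) := by
  have : (minCut h P : (State N → ℝ) → ℝ) = fun lam =>
      Finset.univ.inf' Finset.univ_nonempty fun Ω : Cut N => cutValue h P lam Ω := by
    ext lam
    rw [minCut, Finset.inf'_univ_eq_ciInf]
  rw [this]
  refine Continuous.finset_inf'_apply _ fun Ω _ => ?_
  unfold cutValue activation
  fun_prop

instance (N : ℕ) : Nonempty (State N) :=
  ⟨⟨fun _ => ∅, fun _ => ∅, by simp, by simp, by simp, by simp, by simp, rfl, rfl⟩⟩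

theorem isGreatest_approxCapacity (h : Node N → Node N → ℂ) (P : ℝ) :
    IsGreatest (minCutValues h P) (approxCapacity h P) := by
  have heq : minCutValues h P = minCut h P '' stdSimplex ℝ (State N) := by
    ext c
    simp only [minCutValues, isSchedule_iff]
    exact ⟨fun ⟨lam, h1, h2⟩ => ⟨lam, h1, h2.symm⟩, fun ⟨lam, h1, h2⟩ => ⟨lam, h1, h2.symm⟩⟩
  have hc : IsCompact (minCutValues h P) := by
    rw [heq]
    exact (isCompact_stdSimplex ℝ _).image (continuous_minCut h P)
  have hne : (minCutValues h P).Nonempty := by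
    classical
    exact ⟨_, _, isSchedule_single (Classical.arbitrary (State N)), rfl⟩
  exact hc.isGreatest_sSup hne

theorem le_minCut {h : Node N → Node N → ℂ} {P : ℝ} {lam : State N → ℝ} {c : ℝ}
    (hc : ∀ Ω : Finset (Node N), src N ∈ Ω → dst N ∉ Ω → c ≤ cutValue h P lam Ω) :
    c ≤ minCut h P lam :=
  le_ciInf fun Ω => hc Ω Ω.2.1 Ω.2.2

theorem minCut_le (h : Node N → Node N → ℂ) (P : ℝ) (lam : State N → ℝ) {Ω : Finset (Node N)}
    (hs : src N ∈ Ω) (ht : dst N ∉ Ω) : minCut h P lam ≤ cutValue h P lam Ω :=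
  ciInf_le (f := fun Ω : Cut N => cutValue h P lam Ω) (Set.finite_range _).bddBelow ⟨Ω, hs, ht⟩

/-- Flows vanish outside the links, so that the restricted sums of the program are net flows. -/
theorem sum_sub_sum_eq_netOut {F : Node N → Node N → ℝ}
    (hF : ∀ j i, ¬ IsLink j i → F j i = 0) (i : Node N) :
    ∑ j with j ≠ src N ∧ j ≠ i, F j i - ∑ k with k ≠ dst N ∧ k ≠ i, F i k = netOut F i := by
  unfold netOut
  congr 1
  · refine Finset.sum_subset (Finset.filter_subset _ _) fun j _ hj => hF _ _ fun hl => hj ?_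
    simpa using hl.2
  · refine Finset.sum_subset (Finset.filter_subset _ _) fun k _ hk => hF _ _ fun hl => hk ?_
    simpa using ⟨hl.1, hl.2.2.symm⟩

theorem sum_ne_src_eq_netOut {F : Node N → Node N → ℝ}
    (hF : ∀ j i, ¬ IsLink j i → F j i = 0) :
    ∑ j with j ≠ src N, F j (src N) = netOut F (src N) := by
  have h : ∑ k with k ≠ dst N ∧ k ≠ src N, F (src N) k = 0 :=
    Finset.sum_eq_zero fun k _ => hF _ _ fun hl => hl.2.1 rfl
  rw [← sum_sub_sum_eq_netOut hF, h, sub_zero]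
  simp only [and_self]

theorem minCut_mem_P1Values {h : Node N → Node N → ℂ} {P : ℝ} (hP : 0 ≤ P) {lam : State N → ℝ}
    (hlam : IsSchedule lam) : minCut h P lam ∈ P1Values h P := by
  set c : Node N → Node N → ℝ := fun j i => activation lam j i * linkCap h P j i with hc
  have hc0 : ∀ j i, 0 ≤ c j i := fun j i =>
    mul_nonneg (hlam.activation_nonneg j i) (linkCap_nonneg h hP j i)
  obtain ⟨F, hF, Ω, hs, ht, hΩ⟩ := exists_flow_eq_cut hc0 (src_ne_dst N)
  have hF0 : ∀ j i, ¬ IsLink j i → F j i = 0 := fun j i hl =>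
    le_antisymm ((hF.le_cap j i).trans_eq (by simp [hc, activation_eq_zero lam hl]))
      (hF.nonneg j i)
  have hX := hlam.isFracMatching
  have hd : ∀ i, activation lam i i + activation lam i i = 0 := fun i => by
    rw [activation_eq_zero lam fun hl => hl.2.2 rfl, add_zero]
  refine ⟨F, activation lam, fun i j => activation lam i j + activation lam j i,
    ⟨fun i j _ _ => ⟨hF.nonneg j i, hF.le_cap j i⟩, fun i hi hi' => ?_, fun _ _ _ => rfl,
      hlam.activation_nonneg, fun v => ?_, fun S hS => ?_, fun i j _ => hX.nonneg i j⟩, ?_⟩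
  · rw [← sub_eq_zero, sum_sub_sum_eq_netOut hF0]
    exact hF.conserved i hi hi'
  · rw [sum_incident_lt hX.symm hd]
    exact hX.degree v
  · have h1 := two_mul_sum_inside_lt hX.symm hd S
    have h2 := hX.odd_set S hS
    rw [le_div_iff₀ two_pos, mul_comm, h1]
    exact h2
  · rw [sum_ne_src_eq_netOut hF0]
    refine le_antisymm ?_ (le_minCut fun Ω' hs' ht' => hF.netOut_le_cut hs' ht')
    rw [hΩ]
    exact minCut_le h P lam hs ht

open Classical in
theorem P1Feasible.isFracMatching {h : Node N → Node N → ℂ} {P : ℝ}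
    {F lam lamHat : Node N → Node N → ℝ} (hf : P1Feasible h P F lam lamHat) :
    IsFracMatching fun i j =>
      (if IsLink i j then lam i j else 0) + (if IsLink j i then lam j i else 0) := by
  -- The diagonal is cleared because the degree and odd-set constraints of P1 do not bound λ_ii.
  set Y : Node N → Node N → ℝ := fun i j => if i = j then 0 else lam i j + lam j i with hYdef
  have hYs : ∀ i j, Y i j = Y j i := fun i j => by
    by_cases h : i = j
    · rw [h]
    · simp [Y, h, Ne.symm h, add_comm]
  have hYd : ∀ i, Y i i = 0 := fun i => by simp [Y]
  have hYhat : ∀ i j, i < j → lamHat i j = Y i j := fun i j hij => by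
    simp [Y, hij.ne, hf.lamHat_eq i j hij]
  have hY : IsFracMatching Y := by
    refine ⟨fun i j => ?_, hYs, fun v => ?_, fun S hS => ?_⟩
    · have := hf.lam_nonneg i j
      have := hf.lam_nonneg j i
      simp only [Y]
      split_ifs <;> linarith
    · rw [← sum_incident_lt hYs hYd]
      refine le_trans (le_of_eq ?_) (hf.degree v)
      exact Finset.sum_congr rfl fun p hp => (hYhat _ _ (Finset.mem_filter.1 hp).2.2).symm
    · rw [← two_mul_sum_inside_lt hYs hYd]
      have h1 := hf.odd_set S hS
      rw [Finset.sum_congr rfl fun p hp => hYhat _ _ (Finset.mem_filter.1 hp).2.2.2] at h1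
      linarith
  refine hY.mono (fun i j => ?_) (fun i j => add_comm _ _) fun i j => ?_
  · have := hf.lam_nonneg i j
    have := hf.lam_nonneg j i
    split_ifs <;> linarith
  · have := hf.lam_nonneg i j
    have := hf.lam_nonneg j i
    by_cases hij : i = j
    · have : ¬ IsLink j j := fun hl => hl.2.2 rfl
      simp [hij, this, Y]
    · simp only [Y, if_neg hij]
      split_ifs <;> linarith

theorem le_approxCapacity_of_feasible {h : Node N → Node N → ℂ} {P : ℝ} (hP : 0 ≤ P) {c : ℝ}
    (hc : c ∈ P1Values h P) : c ≤ approxCapacity h P := by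
  classical
  obtain ⟨F, lam, lamHat, hf, rfl⟩ := hc
  obtain ⟨μ, hμ, hle⟩ := exists_schedule_activation_ge
    (a := fun j i => if IsLink j i then lam j i else 0)
    (fun j i => by have := hf.lam_nonneg j i; positivity)
    (fun j i hl => if_neg hl) hf.isFracMatching
  -- Self-loops and entries into the source or out of the destination affect neither conservation
  -- nor the objective. Discarding them leaves a genuine flow, bounded by every cut.
  set G : Node N → Node N → ℝ := fun j i => if IsLink j i then F j i else 0 with hG
  have hG0 : ∀ j i, ¬ IsLink j i → G j i = 0 := fun j i hl => if_neg hl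
  have hcap : ∀ j i, IsLink j i → 0 ≤ F j i ∧ F j i ≤ lam j i * linkCap h P j i :=
    fun j i hl => hf.capacity i j hl.1 hl.2.1
  have hflow : IsFlow (fun j i => activation μ j i * linkCap h P j i) (src N) (dst N) G := by
    refine ⟨fun j i => ?_, fun j i => ?_, fun i hi hi' => ?_⟩
    · by_cases hl : IsLink j i
      · simp [hG, hl, (hcap j i hl).1]
      · exact (hG0 j i hl).ge
    · by_cases hl : IsLink j i
      · have h1 := hle j i
        simp only [hl, if_true] at h1
        simp only [hG, hl, if_true]
        exact (hcap j i hl).2.trans (mul_le_mul_of_nonneg_right h1 (linkCap_nonneg h hP j i))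
      · rw [hG0 j i hl]
        exact mul_nonneg (hμ.activation_nonneg j i) (linkCap_nonneg h hP j i)
    · rw [← sum_sub_sum_eq_netOut hG0, sub_eq_zero]
      refine Eq.trans ?_ ((hf.conservation i hi hi').trans ?_)
      · refine Finset.sum_congr rfl fun j hj => if_pos ?_
        exact ⟨hi', (Finset.mem_filter.1 hj).2⟩
      · refine Finset.sum_congr rfl fun k hk => (if_pos ?_).symm
        have := (Finset.mem_filter.1 hk).2
        exact ⟨this.1, hi, this.2.symm⟩
  have hval : ∑ j with j ≠ src N, F j (src N) = netOut G (src N) := by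
    rw [← sum_ne_src_eq_netOut hG0]
    refine Finset.sum_congr rfl fun j hj => (if_pos ?_).symm
    have := (Finset.mem_filter.1 hj).2
    exact ⟨src_ne_dst N, this, this⟩
  rw [hval]
  refine le_trans ?_ ((isGreatest_approxCapacity h P).2 ⟨μ, hμ, rfl⟩)
  exact le_minCut fun Ω hs ht => hflow.netOut_le_cut hs ht

end OneTwoOne

theorem theorem2 (N : ℕ) (h : OneTwoOne.Node N → OneTwoOne.Node N → ℂ) (P : ℝ) (hP : 0 ≤ P) :
    IsGreatest (OneTwoOne.minCutValues h P) (OneTwoOne.approxCapacity h P) ∧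
      IsGreatest (OneTwoOne.P1Values h P) (OneTwoOne.approxCapacity h P) := by
  have hg := OneTwoOne.isGreatest_approxCapacity h P
  refine ⟨hg, ?_, fun c hc => OneTwoOne.le_approxCapacity_of_feasible hP hc⟩
  obtain ⟨lam, hlam, heq⟩ := hg.1
  rw [heq]
  exact OneTwoOne.minCut_mem_P1Values hP hlam
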